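/- Let $G$ be a probability measure on $(0,\infty)$ having a density $g\ge 0$ that is continuous on $(0,\infty)$, let $U$ be a random variable with law $G$, and let $$R(\mathbf h)=\int_0^\infty \exp\Big\{-\frac{|\mathbf h|^2}{2u}\Big\}\,dG(u),\qquad \mathbf h\in\mathbb R^d,$$ where $|\cdot|$ is the Euclidean norm. For real functions $f_1,f_2$ write $f_1\asymp f_2$ (in a given limit) if $f_1/f_2$ converges to some constant $c\in(0,\infty)$. (i) Let $m\ge 0$ be an integer with $E[U^{-m}]<\infty$. Then every real Gaussian process $(Z(\mathbf s))_{\mathbf s\in\mathbb R^d}$ with constant mean and $\operatorname{Cov}(Z(\mathbf s),Z(\mathbf t))=R(\mathbf s-\mathbf t)$ is $m$-times mean-square differentiable, i.e. the map $\mathbf s\mapsto Z(\mathbf s)$ from $\mathbb R^d$ to $L^2$ is $m$ times Fréchet differentiable. (ii) Let $L$ be slowly varying at $\infty$, i.e. $\lim_{x\to\infty}L(tx)/L(x)=1$ for all $t\in(0,\infty)$, let $c_0\ge 0$ and $\lambda\in\mathbb R$, and assume $$g(u)\asymp e^{-c_0u}\,u^{\lambda-2}\,L(u)\qquad (u\to\infty).$$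 If $c_0=0$ and $\lambda<1$, then $R(\mathbf h)\asymp|\mathbf h|^{2\lambda-2}L(|\mathbf h|^2)$ as $|\mathbf h|\to\infty$. If $c_0>0$, then $R(\mathbf h)\asymp|\mathbf h|^{\lambda-3/2}L(|\mathbf h|)\exp\{-(2c_0)^{1/2}|\mathbf h|\}$ as $|\mathbf h|\to\infty$. -/

import Mathlib

open MeasureTheory ProbabilityTheory Filter Topology Set

/-- The normal scale mixture `R(h) = ∫_0^∞ exp (-|h|² / (2u)) dG(u)` on `ℝ^d`, with the Euclidean
norm. -/
noncomputable def normalScaleMixture {d : ℕ} (G : Measure ℝ) (h : EuclideanSpace ℝ (Fin d)) : ℝ :=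
  ∫ u in Ioi (0 : ℝ), Real.exp (-(‖h‖ ^ 2 / (2 * u))) ∂G

/-- `Z` is a Gaussian process on `ℝ^d` with constant mean and covariance function
`Cov (Z s) (Z t) = R (s - t)`. -/
structure IsStationaryGaussianProcess {d : ℕ} {Ω : Type*} [MeasurableSpace Ω]
    (Z : EuclideanSpace ℝ (Fin d) → Ω → ℝ) (R : EuclideanSpace ℝ (Fin d) → ℝ)
    (P : Measure Ω) : Prop where
  isGaussian : IsGaussianProcess Z P
  mean_const : ∃ a : ℝ, ∀ s, ∫ ω, Z s ω ∂P = a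
  cov_eq : ∀ s t, cov[Z s, Z t; P] = R (s - t)

/-- `m`-times mean-square differentiability of a real process on `ℝ^d`: the variables `Z s` are
square integrable and the map `s ↦ Z s` from `ℝ^d` into the Hilbert space `L²(P)` is `m` times
(Fréchet) differentiable, i.e. it and its successive derivatives of order `< m` are differentiable
everywhere, the difference quotients converging in the `L²(P)` norm. -/
def IsMeanSquareDifferentiable {d : ℕ} {Ω : Type*} [MeasurableSpace Ω] (m : ℕ)
    (Z : EuclideanSpace ℝ (Fin d) → Ω → ℝ) (P : Measure Ω) : Prop :=
  ∃ hZ : ∀ s, MemLp (Z s) 2 P,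
    ∀ k < m, Differentiable ℝ (iteratedFDeriv ℝ k (fun s => (hZ s).toLp (Z s)))

/-- `f ≍ g` along the filter `l`: the quotient `f / g` tends to a constant `c ∈ (0, ∞)`.
(As `c ≠ 0`, this forces `g ≠ 0` eventually.) -/
def AsympProportional {α : Type*} (l : Filter α) (f g : α → ℝ) : Prop :=
  ∃ c : ℝ, 0 < c ∧ Tendsto (fun x => f x / g x) l (𝓝 c)

/-- `L` is slowly varying at `∞`. -/
def SlowlyVarying (L : ℝ → ℝ) : Prop :=
  ∀ t : ℝ, 0 < t → Tendsto (fun x => L (t * x) / L x) atTop (𝓝 1)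

/-! For (ii), only a slowly varying factor needs care. Dividing `g` by `exp (-c₀ u) u ^ (lam - 2)`
gives a function `ℓ` that is again slowly varying and, unlike `L`, is continuous and eventually
positive, so Potter's bounds follow from a Baire category argument. They provide dominating
functions, and dominated convergence does the rest. If `c₀ = 0`, the substitution `u = r² v` turns
the mixture into a fixed integral of `exp (-1 / (2v)) v ^ (lam - 2)`. If `c₀ > 0`, the exponent `r²
/ (2u) + c₀ u` is least at `x = r / √(2 c₀)`; completing the square leaves `c₀ (u - x)² / u`, and
Laplace's method on the scale `√x` applies. In both cases the mass on `(0, X]` contributes at most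
`exp (-r² / (2X))`, which is negligible.

For (i), the mixture is the characteristic function of `w / √u`, with `w` standard Gaussian and `u`
of law `G` independent. Hence the characters `exp (i ⟪s, w / √u⟫)` form a curve in a complex `L²`
space with the same real Gram kernel as the centred process. Each derivative of this curve costs one
factor `‖w‖ / √u`, so `E[U^{-m}] < ∞` makes it `C^m`. Equality of Gram kernels gives a continuous
linear map carrying this curve to the centred process, and smoothness is transported with it. -/

/-! ### Slowly varying functions: uniform convergence and Potter's bounds. -/

/-- Uniform convergence theorem for slowly varying functions, in additive form. -/
theorem exists_forall_abs_sub_le_of_tendsto_sub {F : ℝ → ℝ} (hF : Continuous F)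
    (h : ∀ t, Tendsto (fun x => F (x + t) - F x) atTop (𝓝 0)) {ε : ℝ} (hε : 0 < ε) :
    ∃ N, ∀ x, N ≤ x → ∀ t ∈ Icc (0 : ℝ) 1, |F (x + t) - F x| ≤ ε := by
  have hε3 : 0 < ε / 3 := by positivity
  have hev : ∀ t, ∃ N : ℝ, ∀ x, N ≤ x → |F (x + t) - F x| ≤ ε / 3 := by
    intro t
    have := (Metric.tendsto_nhds.1 (h t)) (ε / 3) hε3
    obtain ⟨N, hN⟩ := eventually_atTop.1 this
    exact ⟨N, fun x hx => by simpa [Real.dist_eq] using (hN x hx).le⟩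
  -- Baire category: these sets are closed since `F` is continuous, and they cover the line, so one
  -- of them contains an interval of shifts with a common threshold.
  let A : ℕ → Set ℝ := fun n => {t | ∀ x : ℝ, (n : ℝ) ≤ x → |F (x + t) - F x| ≤ ε / 3}
  have hA : ∀ n, IsClosed (A n) := by
    intro n
    simp only [A, ofPred_forall]
    refine isClosed_iInter fun x => isClosed_iInter fun _ => ?_
    exact isClosed_le (by fun_prop) continuous_const
  have hU : ⋃ n, A n = univ := by
    refine eq_univ_of_forall fun t => ?_
    obtain ⟨N, hN⟩ := hev t
    obtain ⟨n, hn⟩ := exists_nat_ge N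
    exact mem_iUnion.2 ⟨n, fun x hx => hN x (hn.trans hx)⟩
  obtain ⟨n, a, ha⟩ := nonempty_interior_of_iUnion_of_closed hA hU
  obtain ⟨δ, hδ, hball⟩ := Metric.mem_nhds_iff.1 (mem_interior_iff_mem_nhds.1 ha)
  -- Comparing both values with the one at `x - a` moves the uniformity from shifts near `a` to
  -- shifts near `0`.
  have hsmall : ∀ x, n + a ≤ x → ∀ s, 0 ≤ s → s < δ → |F (x + s) - F x| ≤ ε / 3 + ε / 3 := by
    intro x hx s hs hsδ
    have h1 := hball (show a + s ∈ Metric.ball a δ by simp [abs_of_nonneg hs, hsδ]) (x - a)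
      (by linarith)
    have h2 := hball (Metric.mem_ball_self hδ) (x - a) (by linarith)
    rw [show x - a + (a + s) = x + s by ring] at h1
    rw [show x - a + a = x by ring] at h2
    rw [abs_le] at *
    constructor <;> linarith
  -- A grid of mesh `1 / k < δ` reduces `[0, 1]` to finitely many shifts followed by a small one.
  obtain ⟨k, hk⟩ := exists_nat_gt (1 / δ)
  have hk0 : (0 : ℝ) < k := lt_trans (by positivity) hk
  choose M hM using hev
  obtain ⟨B, hB⟩ := (Finset.finite_toSet ((Finset.range (k + 1)).image
    fun j : ℕ => M (j / k))).bddAbove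
  refine ⟨max B (n + a), fun x hx t ht => ?_⟩
  have hfl : ⌊t * k⌋₊ ≤ k := Nat.floor_le_of_le (by nlinarith [ht.2])
  have hle := Nat.floor_le (a := t * k) (mul_nonneg ht.1 hk0.le)
  have hlt := Nat.lt_floor_add_one (t * k)
  set j := ⌊t * k⌋₊
  have h0 : (0 : ℝ) ≤ j / k := by positivity
  have h1 : (j / k : ℝ) ≤ t := by rwa [div_le_iff₀ hk0]
  have h2 : t - j / k < δ := by
    have : t < (j + 1) / k := by rwa [lt_div_iff₀ hk0]
    have h3 : (1 : ℝ) / k < δ := by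
      rw [div_lt_iff₀ hk0]; rwa [div_lt_iff₀ hδ, mul_comm] at hk
    rw [add_div] at this
    linarith
  have hMB : M (j / k) ≤ B := hB (by
    simp only [Finset.coe_image, mem_image, Finset.mem_coe, Finset.mem_range]
    exact ⟨j, by omega, rfl⟩)
  have e1 := hM (j / k) x (hMB.trans ((le_max_left _ _).trans hx))
  have e2 := hsmall (x + j / k) (by linarith [(le_max_right B (n + a)).trans hx]) (t - j / k)
    (by linarith) h2
  rw [show x + j / k + (t - j / k) = x + t by ring] at e2
  rw [abs_le] at *
  constructor <;> linarith

/-- Potter's bounds, in additive form. -/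
theorem exists_forall_abs_sub_le_mul_add {F : ℝ → ℝ} (hF : Continuous F)
    (h : ∀ t, Tendsto (fun x => F (x + t) - F x) atTop (𝓝 0)) {ε δ : ℝ} (hε : 0 < ε)
    (hδ : 0 < δ) :
    ∃ N, ∀ x, N ≤ x → ∀ y, N ≤ y → |F y - F x| ≤ δ * |y - x| + ε := by
  -- With tolerance `min δ ε`, each unit step costs at most `δ` and the fractional remainder at most
  -- `ε`.
  obtain ⟨N, hN⟩ := exists_forall_abs_sub_le_of_tendsto_sub hF h (lt_min hδ hε)
  have hstep : ∀ n : ℕ, ∀ x, N ≤ x → |F (x + n) - F x| ≤ n * min δ ε := by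
    intro n x hx
    induction n with
    | zero => simp
    | succ n ih =>
      have h1 := hN (x + n) (by linarith [n.cast_nonneg (α := ℝ)]) 1 (by simp)
      rw [abs_le] at *
      push_cast
      rw [← add_assoc]
      constructor <;> linarith
  have key : ∀ x, N ≤ x → ∀ y, x ≤ y → |F y - F x| ≤ δ * |y - x| + ε := by
    intro x hx y hxy
    have hyx : 0 ≤ y - x := by linarith
    have hle := Nat.floor_le hyx
    have hlt := Nat.lt_floor_add_one (y - x)
    set n := ⌊y - x⌋₊
    have h1 := hstep n x hx
    have h2 := hN (x + n) (by linarith [n.cast_nonneg (α := ℝ)]) (y - x - n)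
      ⟨by linarith, by linarith⟩
    rw [show x + n + (y - x - n) = y by ring] at h2
    have h3 : n * min δ ε ≤ δ * (y - x) := by
      calc n * min δ ε ≤ n * δ := by gcongr; exact min_le_left _ _
        _ ≤ δ * (y - x) := by rw [mul_comm]; gcongr
    have h4 := min_le_right δ ε
    rw [abs_of_nonneg hyx]
    rw [abs_le] at *
    constructor <;> linarith
  refine ⟨N, fun x hx y hy => ?_⟩
  rcases le_total x y with hxy | hxy
  · exact key x hx y hxy
  · rw [abs_sub_comm, abs_sub_comm y x]
    exact key y hy x hxy

/-- Potter's bounds for an eventually positive continuous slowly varying function. -/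
theorem SlowlyVarying.exists_abs_log_sub_log_le {ℓ : ℝ → ℝ} (hs : SlowlyVarying ℓ)
    (hc : ContinuousOn ℓ (Ioi 0)) (hpos : ∀ᶠ x in atTop, 0 < ℓ x) {ε δ : ℝ} (hε : 0 < ε)
    (hδ : 0 < δ) :
    ∃ X, 1 ≤ X ∧ ∀ x, X ≤ x → 0 < ℓ x ∧ ∀ y, X ≤ y →
      |Real.log (ℓ y) - Real.log (ℓ x)| ≤ δ * |Real.log y - Real.log x| + ε := by
  obtain ⟨X₀, hX₀⟩ := eventually_atTop.1 (hpos.and (eventually_ge_atTop 1))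
  have hX₁ : 1 ≤ X₀ := (hX₀ X₀ le_rfl).2
  have hX0 : 0 < X₀ := by linarith
  -- The clamp at `log X₀` keeps the argument where `ℓ` is positive, so that `F` is continuous on
  -- the whole line.
  let F : ℝ → ℝ := fun x => Real.log (ℓ (Real.exp (max x (Real.log X₀))))
  have hexp : ∀ x, X₀ ≤ Real.exp (max x (Real.log X₀)) := fun x => by
    rw [← Real.log_le_iff_le_exp hX0]; exact le_max_right _ _
  have hF : Continuous F := by
    refine Continuous.log ?_ fun x => (hX₀ _ (hexp x)).1.ne'
    exact hc.comp_continuous (by fun_prop) fun x => Real.exp_pos _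
  have hFl : ∀ x, X₀ ≤ x → F (Real.log x) = Real.log (ℓ x) := by
    intro x hx
    simp only [F]
    rw [max_eq_left (Real.log_le_log hX0 hx), Real.exp_log (by linarith)]
  have hlim : ∀ t, Tendsto (fun x => F (x + t) - F x) atTop (𝓝 0) := by
    intro t
    have h1 := ((Real.continuousAt_log one_ne_zero).tendsto.comp
      ((hs (Real.exp t) (Real.exp_pos t)).comp Real.tendsto_exp_atTop))
    rw [Real.log_one] at h1
    refine h1.congr' ?_
    filter_upwards [eventually_ge_atTop (Real.log X₀),
      eventually_ge_atTop (Real.log X₀ - t)] with x hx hxt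
    have e1 : max x (Real.log X₀) = x := max_eq_left hx
    have e2 : max (x + t) (Real.log X₀) = x + t := max_eq_left (by linarith)
    have p1 := (hX₀ _ (hexp x)).1
    have p2 := (hX₀ _ (hexp (x + t))).1
    simp only [F]
    rw [e1] at p1 ⊢
    rw [e2] at p2 ⊢
    rw [Real.exp_add, mul_comm] at p2 ⊢
    exact Real.log_div p2.ne' p1.ne'
  obtain ⟨N, hN⟩ := exists_forall_abs_sub_le_mul_add hF hlim hε hδ
  refine ⟨max X₀ (Real.exp N), hX₁.trans (le_max_left _ _), fun x hx => ?_⟩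
  have hx₀ : X₀ ≤ x := (le_max_left _ _).trans hx
  refine ⟨(hX₀ x hx₀).1, fun y hy => ?_⟩
  have hy₀ : X₀ ≤ y := (le_max_left _ _).trans hy
  rw [← hFl x hx₀, ← hFl y hy₀]
  refine hN _ ?_ _ ?_
  · rw [Real.le_log_iff_exp_le (by linarith)]; exact (le_max_right _ _).trans hx
  · rw [Real.le_log_iff_exp_le (by linarith)]; exact (le_max_right _ _).trans hy

/-- Potter's bounds, in multiplicative form. -/
theorem SlowlyVarying.exists_div_le {ℓ : ℝ → ℝ} (hs : SlowlyVarying ℓ)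
    (hc : ContinuousOn ℓ (Ioi 0)) (hpos : ∀ᶠ x in atTop, 0 < ℓ x) {δ : ℝ} (hδ : 0 < δ) :
    ∃ X, 1 ≤ X ∧ ∀ x, X ≤ x → 0 < ℓ x ∧ ∀ y, X ≤ y →
      ℓ y / ℓ x ≤ Real.exp 1 * ((y / x) ^ δ + (y / x) ^ (-δ)) := by
  obtain ⟨X, hX1, hX⟩ := hs.exists_abs_log_sub_log_le hc hpos one_pos hδ
  refine ⟨X, hX1, fun x hx => ⟨(hX x hx).1, fun y hy => ?_⟩⟩
  have hx0 : 0 < x := by linarith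
  have hy0 : 0 < y := by linarith
  have hlx := (hX x hx).1
  have hly := (hX y hy).1
  have h1 := (hX x hx).2 y hy
  rw [← Real.log_div hy0.ne' hx0.ne', ← Real.log_div hly.ne' hlx.ne'] at h1
  have hv : 0 < y / x := by positivity
  rw [Real.rpow_def_of_pos hv, Real.rpow_def_of_pos hv, ← Real.exp_log (div_pos hly hlx)]
  have h2 := (le_abs_self _).trans h1
  rcases abs_cases (Real.log (y / x)) with ⟨h3, -⟩ | ⟨h3, -⟩
  · rw [h3] at h2
    calc _ ≤ Real.exp 1 * Real.exp (Real.log (y / x) * δ) := by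
          rw [← Real.exp_add]; exact Real.exp_le_exp.2 (by linarith)
      _ ≤ _ := by gcongr; linarith [Real.exp_pos (Real.log (y / x) * -δ)]
  · rw [h3] at h2
    calc _ ≤ Real.exp 1 * Real.exp (Real.log (y / x) * -δ) := by
          rw [← Real.exp_add]; exact Real.exp_le_exp.2 (by linarith)
      _ ≤ _ := by gcongr; linarith [Real.exp_pos (Real.log (y / x) * δ)]

/-- A slowly varying function is asymptotically constant on scales `y / x → 1`. -/
theorem SlowlyVarying.tendsto_div_of_tendsto_div_one {ℓ : ℝ → ℝ} (hs : SlowlyVarying ℓ)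
    (hc : ContinuousOn ℓ (Ioi 0)) (hpos : ∀ᶠ x in atTop, 0 < ℓ x) {φ : ℝ → ℝ}
    (hφ : Tendsto (fun x => φ x / x) atTop (𝓝 1)) :
    Tendsto (fun x => ℓ (φ x) / ℓ x) atTop (𝓝 1) := by
  have hφ' : Tendsto φ atTop atTop := by
    have := hφ.pos_mul_atTop one_pos tendsto_id
    refine this.congr' ?_
    filter_upwards [eventually_ne_atTop 0] with x hx
    simp [div_mul_cancel₀ _ hx]
  have hlog : Tendsto (fun x => Real.log (φ x / x)) atTop (𝓝 0) := by
    rw [← Real.log_one]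
    exact (Real.continuousAt_log one_ne_zero).tendsto.comp hφ
  have key : Tendsto (fun x => Real.log (ℓ (φ x)) - Real.log (ℓ x)) atTop (𝓝 0) := by
    rw [Metric.tendsto_nhds]
    intro ε hε
    obtain ⟨X, hX1, hX⟩ := hs.exists_abs_log_sub_log_le hc hpos (half_pos hε) one_pos
    filter_upwards [eventually_ge_atTop X, hφ'.eventually_ge_atTop X,
      (Metric.tendsto_nhds.1 hlog) (ε / 2) (half_pos hε)] with x hx hφx hl
    have h1 := (hX x hx).2 _ hφx
    rw [← Real.log_div (x := φ x) (y := x) (by linarith) (by linarith)] at h1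
    rw [Real.dist_eq, sub_zero] at hl ⊢
    linarith
  have := (Real.continuous_exp.tendsto 0).comp key
  rw [Real.exp_zero] at this
  refine this.congr' ?_
  filter_upwards [hpos, hφ'.eventually hpos] with x hx hφx
  simp [Real.exp_sub, Real.exp_log, hx, hφx]

/-! ### The rescaled integral for a power tail. -/

theorem Real.exists_rpow_mul_exp_neg_le (s : ℝ) {b : ℝ} (hb : 0 < b) :
    ∃ C, 0 ≤ C ∧ ∀ y, 1 ≤ y → y ^ s * Real.exp (-(b * y)) ≤ C := by
  refine ⟨(⌈s⌉₊.factorial : ℝ) / b ^ ⌈s⌉₊, by positivity, fun y hy => ?_⟩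
  have hy0 : 0 ≤ y := by linarith
  have h1 : y ^ s ≤ y ^ ⌈s⌉₊ := by
    rw [← Real.rpow_natCast]
    exact Real.rpow_le_rpow_of_exponent_le hy (Nat.le_ceil s)
  have h2 := Real.pow_div_factorial_le_exp (x := b * y) (by positivity) ⌈s⌉₊
  rw [Real.exp_neg, ← div_eq_mul_inv, div_le_iff₀ (Real.exp_pos _)]
  refine h1.trans ?_
  calc y ^ ⌈s⌉₊ = (⌈s⌉₊.factorial : ℝ) / b ^ ⌈s⌉₊ * ((b * y) ^ ⌈s⌉₊ / ⌈s⌉₊.factorial) := by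
        rw [mul_pow]; field_simp
    _ ≤ _ := by gcongr

theorem continuousOn_exp_neg_inv_mul_rpow (a : ℝ) :
    ContinuousOn (fun v : ℝ => Real.exp (-(1 / (2 * v))) * v ^ a) (Ioi 0) := by
  intro v hv
  have hv0 : v ≠ 0 := (mem_Ioi.1 hv).ne'
  refine ContinuousAt.continuousWithinAt (ContinuousAt.mul ?_ ?_)
  · fun_prop (disch := simpa using hv0)
  · exact Real.continuousAt_rpow_const _ _ (Or.inl hv0)

theorem integrableOn_exp_neg_inv_mul_rpow {a : ℝ} (ha : a < -1) :
    IntegrableOn (fun v : ℝ => Real.exp (-(1 / (2 * v))) * v ^ a) (Ioi 0) := by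
  have hcont := continuousOn_exp_neg_inv_mul_rpow a
  rw [← Ioc_union_Ioi_eq_Ioi zero_le_one, integrableOn_union]
  constructor
  · obtain ⟨C, -, hC⟩ := Real.exists_rpow_mul_exp_neg_le (-a) (b := 1 / 2) (by norm_num)
    refine IntegrableOn.of_bound (by simp)
      ((hcont.mono Ioc_subset_Ioi_self).aestronglyMeasurable measurableSet_Ioc) C ?_
    filter_upwards [ae_restrict_mem measurableSet_Ioc] with v hv
    have hv0 : 0 < v := hv.1
    have := hC v⁻¹ ((one_le_inv₀ hv0).2 hv.2)
    rw [Real.inv_rpow hv0.le, Real.rpow_neg hv0.le, inv_inv] at this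
    rw [Real.norm_of_nonneg (by positivity), mul_comm]
    convert this using 4
    field_simp
  · refine (integrableOn_Ioi_rpow_of_lt ha one_pos).mono'
      ((hcont.mono (Ioi_subset_Ioi zero_le_one)).aestronglyMeasurable measurableSet_Ioi) ?_
    filter_upwards [ae_restrict_mem measurableSet_Ioi] with v hv
    have hv0 : 0 < v := one_pos.trans hv
    rw [Real.norm_of_nonneg (by positivity)]
    refine mul_le_of_le_one_left (by positivity) (Real.exp_le_one_iff.2 ?_)
    simp only [Left.neg_nonpos_iff]
    positivity

theorem setIntegral_exp_neg_inv_mul_rpow_pos {a : ℝ} (ha : a < -1) :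
    0 < ∫ v in Ioi (0 : ℝ), Real.exp (-(1 / (2 * v))) * v ^ a := by
  rw [setIntegral_pos_iff_support_of_nonneg_ae _ (integrableOn_exp_neg_inv_mul_rpow ha)]
  · have : (Function.support fun v : ℝ => Real.exp (-(1 / (2 * v))) * v ^ a) ∩ Ioi 0
        = Ioi 0 := by
      refine inter_eq_right.2 fun v hv => ?_
      have hv0 : 0 < v := hv
      exact (by positivity : 0 < Real.exp (-(1 / (2 * v))) * v ^ a).ne'
    rw [this]
    simp
  · filter_upwards [ae_restrict_mem measurableSet_Ioi] with v hv
    have hv0 : 0 < v := hv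
    simp only [Pi.zero_apply]
    positivity

/-- Substituting `u = r² v` leaves `ℓ (r² v) / ℓ (r²)`, which tends to `1` pointwise. Potter's bound
dominates it by `v ^ δ + v ^ (-δ)`; the condition `δ < 1 - lam` keeps both resulting exponents below
`-1`, as integrability at infinity requires. -/
theorem tendsto_setIntegral_exp_neg_sq_div_mul_rpow {ℓ : ℝ → ℝ} (hs : SlowlyVarying ℓ)
    (hc : ContinuousOn ℓ (Ioi 0)) {lam δ X : ℝ} (hδ : 0 < δ)
    (hδl : δ < 1 - lam) (hX1 : 1 ≤ X)
    (hX : ∀ x, X ≤ x → 0 < ℓ x ∧ ∀ y, X ≤ y →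
      ℓ y / ℓ x ≤ Real.exp 1 * ((y / x) ^ δ + (y / x) ^ (-δ))) :
    Tendsto (fun r : ℝ => (∫ u in Ioi X, Real.exp (-(r ^ 2 / (2 * u))) * (u ^ (lam - 2) * ℓ u)) /
      (r ^ (2 * lam - 2) * ℓ (r ^ 2))) atTop
      (𝓝 (∫ v in Ioi (0 : ℝ), Real.exp (-(1 / (2 * v))) * v ^ (lam - 2))) := by
  let Φ : ℝ → ℝ → ℝ := fun r => (Ioi (X / r ^ 2)).indicator fun v =>
    Real.exp (-(1 / (2 * v))) * v ^ (lam - 2) * (ℓ (r ^ 2 * v) / ℓ (r ^ 2))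
  have hX0 : 0 < X := by linarith
  have hr2 : ∀ᶠ r : ℝ in atTop, X ≤ r ^ 2 :=
    (tendsto_pow_atTop two_ne_zero).eventually_ge_atTop X
  have hΦ : ∀ᶠ r : ℝ in atTop, ∫ v in Ioi (0 : ℝ), Φ r v =
      (∫ u in Ioi X, Real.exp (-(r ^ 2 / (2 * u))) * (u ^ (lam - 2) * ℓ u)) /
        (r ^ (2 * lam - 2) * ℓ (r ^ 2)) := by
    filter_upwards [eventually_gt_atTop 0, hr2] with r hr hrX
    have hsub : Ioi (X / r ^ 2) ⊆ Ioi 0 := Ioi_subset_Ioi (by positivity)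
    have hlr := (hX _ hrX).1
    rw [setIntegral_indicator measurableSet_Ioi, inter_eq_right.2 hsub]
    have h1 := integral_comp_mul_left_Ioi'
      (fun u : ℝ => Real.exp (-(r ^ 2 / (2 * u))) * (u ^ (lam - 2) * ℓ u)) (X / r ^ 2)
      (b := r ^ 2) (by positivity)
    rw [mul_div_cancel₀ _ (by positivity : r ^ 2 ≠ 0)] at h1
    rw [← h1, smul_eq_mul, ← integral_const_mul, div_eq_mul_inv _ (_ * _), ← integral_mul_const]
    refine setIntegral_congr_fun measurableSet_Ioi fun v hv => ?_
    have hv0 : 0 < v := hsub hv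
    have e1 : r ^ 2 / (2 * (r ^ 2 * v)) = 1 / (2 * v) := by field_simp
    have e2 : (r ^ 2 * v) ^ (lam - 2) = r ^ (2 * lam - 2) / r ^ 2 * v ^ (lam - 2) := by
      rw [Real.mul_rpow (by positivity) hv0.le, ← Real.rpow_natCast r 2, ← Real.rpow_mul hr.le,
        ← Real.rpow_sub hr]
      congr 2
      push_cast
      ring
    have e3 : r ^ (2 * lam - 2) ≠ 0 := by positivity
    simp only [e1, e2]
    field_simp
  refine Tendsto.congr' hΦ ?_
  refine tendsto_integral_filter_of_dominated_convergence
    (fun v => Real.exp 1 * (Real.exp (-(1 / (2 * v))) * v ^ (lam - 2 + δ) +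
      Real.exp (-(1 / (2 * v))) * v ^ (lam - 2 + -δ))) ?_ ?_ ?_ ?_
  · filter_upwards [eventually_gt_atTop 0] with r hr
    have hsub : Ioi (X / r ^ 2) ⊆ Ioi 0 := Ioi_subset_Ioi (by positivity)
    rw [aestronglyMeasurable_indicator_iff measurableSet_Ioi, Measure.restrict_restrict
      measurableSet_Ioi, inter_eq_left.2 hsub]
    refine ContinuousOn.aestronglyMeasurable ?_ measurableSet_Ioi
    refine ContinuousOn.mono (s := Ioi (0 : ℝ)) ?_ hsub
    refine (continuousOn_exp_neg_inv_mul_rpow _).mul ?_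
    refine ContinuousOn.div_const (hc.comp (f := fun v : ℝ => r ^ 2 * v) (s := Ioi 0) (by fun_prop) fun v hv => ?_) _
    exact mul_pos (pow_pos hr 2) hv
  · filter_upwards [eventually_gt_atTop 0, hr2] with r hr hrX
    filter_upwards [ae_restrict_mem measurableSet_Ioi] with v hv
    have hv0 : 0 < v := hv
    have hlr := (hX _ hrX).1
    simp only [Φ, indicator]
    split_ifs with hvX
    · have hvX' : X ≤ r ^ 2 * v := by
        rw [mem_Ioi, div_lt_iff₀ (by positivity)] at hvX; linarith
      have hlrv := (hX _ hvX').1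
      have h1 := (hX _ hrX).2 _ hvX'
      rw [mul_div_cancel_left₀ _ (by positivity : r ^ 2 ≠ 0)] at h1
      rw [Real.norm_of_nonneg (by positivity), Real.rpow_add hv0, Real.rpow_add hv0]
      calc _ ≤ Real.exp (-(1 / (2 * v))) * v ^ (lam - 2) *
            (Real.exp 1 * (v ^ δ + v ^ (-δ))) := by gcongr
        _ = _ := by ring
    · rw [norm_zero]; positivity
  · exact ((integrableOn_exp_neg_inv_mul_rpow (by linarith)).add
      (integrableOn_exp_neg_inv_mul_rpow (by linarith))).const_mul _
  · filter_upwards [ae_restrict_mem measurableSet_Ioi] with v hv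
    have hv0 : 0 < v := hv
    have h1 : Tendsto (fun r : ℝ => ℓ (r ^ 2 * v) / ℓ (r ^ 2)) atTop (𝓝 1) := by
      simpa [Function.comp_def, mul_comm] using
        (hs v hv0).comp (tendsto_pow_atTop (α := ℝ) two_ne_zero)
    have h2 := h1.const_mul (Real.exp (-(1 / (2 * v))) * v ^ (lam - 2))
    rw [mul_one] at h2
    refine h2.congr' ?_
    filter_upwards [(tendsto_pow_atTop (α := ℝ) two_ne_zero).eventually_gt_atTop (X / v),
      eventually_gt_atTop 0] with r hr hr0
    simp only [Φ]
    rw [indicator_of_mem]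
    rw [mem_Ioi, div_lt_iff₀ (by positivity)]
    rwa [div_lt_iff₀ hv0, mul_comm] at hr

/-! ### Laplace's method for an exponential tail. -/

/-- This supplies the dominating function for Laplace's method, with `v = u / x` and `w = (u - x) /
√x`. Since `v ≤ 1 + |w|`, the exponent satisfies `w² / v ≥ |w| - 1`, which gives exponential decay
in `|w|`. The alternative in the hypotheses excludes small `v` with small `w`, where `v ^ a` could
blow up unchecked. -/
theorem exists_exp_neg_sq_div_mul_rpow_le (a : ℝ) {c : ℝ} (hc : 0 < c) :
    ∃ C, 0 ≤ C ∧ ∀ v w : ℝ, 0 < v → v ≤ 1 + |w| → (1 / 2 ≤ v ∨ 1 / 4 ≤ w ^ 2) →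
      Real.exp (-(c * (w ^ 2 / v))) * v ^ a ≤ C * (1 + |w|) ^ (-2 : ℝ) := by
  obtain ⟨C₁, hC₁0, hC₁⟩ := Real.exists_rpow_mul_exp_neg_le (|a| + 2) hc
  obtain ⟨C₂, hC₂0, hC₂⟩ := Real.exists_rpow_mul_exp_neg_le 2 (half_pos hc)
  obtain ⟨C₃, hC₃0, hC₃⟩ := Real.exists_rpow_mul_exp_neg_le |a| (b := c / 8) (by positivity)
  refine ⟨2 ^ |a| * Real.exp (2 * c) * C₁ + Real.exp c * C₂ * C₃, by positivity,
    fun v w hv hvw h => ?_⟩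
  have hy1 : 1 ≤ 1 + |w| := by linarith [abs_nonneg w]
  have hy0 : 0 < 1 + |w| := by linarith
  have hwv : |w| - 1 ≤ w ^ 2 / v := by
    rw [le_div_iff₀ hv, ← sq_abs]
    rcases le_total |w| 1 with h1 | h1
    · exact (mul_nonpos_of_nonpos_of_nonneg (by linarith) hv.le).trans (by positivity)
    · calc (|w| - 1) * v ≤ (|w| - 1) * (1 + |w|) := by gcongr
        _ ≤ |w| ^ 2 := by ring_nf; linarith
  have hpow : (1 + |w|) ^ (-2 : ℝ) * (1 + |w|) ^ (2 : ℝ) = 1 := by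
    rw [← Real.rpow_add hy0]; simp
  rcases le_or_gt (1 / 2) v with h2 | h2
  · have hva : v ^ a ≤ 2 ^ |a| * (1 + |w|) ^ |a| := by
      rw [← Real.mul_rpow (by norm_num) hy0.le]
      rcases le_total 1 v with hv1 | hv1
      · calc v ^ a ≤ v ^ |a| := Real.rpow_le_rpow_of_exponent_le hv1 (le_abs_self a)
          _ ≤ _ := by gcongr; linarith
      · calc v ^ a ≤ v ^ (-|a|) :=
              Real.rpow_le_rpow_of_exponent_ge hv hv1 (neg_abs_le a)
          _ = (v⁻¹) ^ |a| := by rw [Real.rpow_neg hv.le, Real.inv_rpow hv.le]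
          _ ≤ _ := by
            gcongr
            rw [inv_le_comm₀ hv (by positivity)]
            refine le_trans ?_ h2
            rw [inv_le_comm₀ (by positivity) (by norm_num)]
            norm_num
    have hexp : Real.exp (-(c * (w ^ 2 / v))) ≤
        Real.exp (2 * c) * Real.exp (-(c * (1 + |w|))) := by
      rw [← Real.exp_add, Real.exp_le_exp]
      nlinarith
    calc _ ≤ Real.exp (2 * c) * Real.exp (-(c * (1 + |w|))) *
          (2 ^ |a| * (1 + |w|) ^ |a|) := by gcongr
      _ = 2 ^ |a| * Real.exp (2 * c) *
          ((1 + |w|) ^ (|a| + 2) * Real.exp (-(c * (1 + |w|)))) * (1 + |w|) ^ (-2 : ℝ) := by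
        rw [Real.rpow_add hy0]; linear_combination (-(Real.exp (2 * c) *
          Real.exp (-(c * (1 + |w|))) * 2 ^ |a| * (1 + |w|) ^ |a|)) * hpow
      _ ≤ 2 ^ |a| * Real.exp (2 * c) * C₁ * (1 + |w|) ^ (-2 : ℝ) := by
        gcongr; exact hC₁ _ hy1
      _ ≤ _ := by gcongr; exact le_add_of_nonneg_right (by positivity)
  -- Here `v` may be near `0`. Half of the exponent is spent on decay in `|w|`; the other half is at
  -- least `c / (8v)` and absorbs the power of `v⁻¹`.
  · have h4 : 1 / 4 ≤ w ^ 2 := h.resolve_left (not_le.2 h2)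
    have hv1 : 1 ≤ v⁻¹ := (one_le_inv₀ hv).2 (by linarith)
    have hva : v ^ a ≤ (v⁻¹) ^ |a| := by
      rw [Real.inv_rpow hv.le, ← Real.rpow_neg hv.le]
      exact Real.rpow_le_rpow_of_exponent_ge hv (by linarith) (neg_abs_le a)
    have hexp : Real.exp (-(c * (w ^ 2 / v))) ≤
        Real.exp c * Real.exp (-(c / 2 * (1 + |w|))) * Real.exp (-(c / 8 * v⁻¹)) := by
      rw [← Real.exp_add, ← Real.exp_add, Real.exp_le_exp]
      have h5 : 1 / 4 * v⁻¹ ≤ w ^ 2 / v := by rw [div_eq_mul_inv (w ^ 2)]; gcongr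
      nlinarith
    calc _ ≤ Real.exp c * Real.exp (-(c / 2 * (1 + |w|))) * Real.exp (-(c / 8 * v⁻¹)) *
          (v⁻¹) ^ |a| := by gcongr
      _ = Real.exp c * ((1 + |w|) ^ (2 : ℝ) * Real.exp (-(c / 2 * (1 + |w|)))) *
          ((v⁻¹) ^ |a| * Real.exp (-(c / 8 * v⁻¹))) * (1 + |w|) ^ (-2 : ℝ) := by
        linear_combination (-(Real.exp c * Real.exp (-(c / 2 * (1 + |w|))) *
          Real.exp (-(c / 8 * v⁻¹)) * (v⁻¹) ^ |a|)) * hpow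
      _ ≤ Real.exp c * C₂ * C₃ * (1 + |w|) ^ (-2 : ℝ) := by
        gcongr
        · exact hC₂ _ hy1
        · exact hC₃ _ hv1
      _ ≤ _ := by gcongr; exact le_add_of_nonneg_left (by positivity)

/-- Laplace's method for `∫ exp (-c (u - x)² / u) u^(lam - 2) ℓ(u) du` as `x → ∞`. -/
theorem tendsto_setIntegral_exp_neg_sub_sq_div_mul_rpow {ℓ : ℝ → ℝ} (hs : SlowlyVarying ℓ)
    (hc : ContinuousOn ℓ (Ioi 0)) (hpos : ∀ᶠ x in atTop, 0 < ℓ x) {c δ X : ℝ} (lam : ℝ)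
    (hc0 : 0 < c) (hX1 : 1 ≤ X)
    (hX : ∀ x, X ≤ x → 0 < ℓ x ∧ ∀ y, X ≤ y →
      ℓ y / ℓ x ≤ Real.exp 1 * ((y / x) ^ δ + (y / x) ^ (-δ))) :
    Tendsto (fun x : ℝ => (∫ u in Ioi X, Real.exp (-(c * ((u - x) ^ 2 / u))) *
      (u ^ (lam - 2) * ℓ u)) / (x ^ (lam - 3 / 2) * ℓ x)) atTop (𝓝 √(Real.pi / c)) := by
  let f : ℝ → ℝ → ℝ := fun x => (Ioi X).indicator fun u =>
    Real.exp (-(c * ((u - x) ^ 2 / u))) * (u ^ (lam - 2) * ℓ u)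
  -- On the scale `u = x + √x w` the exponent is `c w² / (u / x)`, which tends to `c w²`; the
  -- Jacobian `√x` changes the power `lam - 2` into `lam - 3 / 2`.
  let Φ : ℝ → ℝ → ℝ := fun x w => f x (x + √x * w) / (x ^ (lam - 2) * ℓ x)
  have hX0 : 0 < X := by linarith
  have hΦ : ∀ᶠ x : ℝ in atTop, ∫ w, Φ x w = (∫ u in Ioi X,
      Real.exp (-(c * ((u - x) ^ 2 / u))) * (u ^ (lam - 2) * ℓ u)) /
        (x ^ (lam - 3 / 2) * ℓ x) := by
    filter_upwards [eventually_ge_atTop X] with x hx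
    have hx0 : 0 < x := by linarith
    have h1 := Measure.integral_comp_mul_left (fun w => f x (x + w)) √x
    rw [integral_add_left_eq_self (f x) x, smul_eq_mul,
      abs_of_nonneg (by positivity)] at h1
    simp only [Φ]
    rw [integral_div, h1, integral_indicator measurableSet_Ioi,
      show lam - 3 / 2 = lam - 2 + 1 / 2 by ring, Real.rpow_add hx0, ← Real.sqrt_eq_rpow]
    field_simp
  have hval : ∀ x w, X ≤ x → X < x + √x * w → Φ x w =
      Real.exp (-(c * (w ^ 2 / ((x + √x * w) / x)))) * ((x + √x * w) / x) ^ (lam - 2) *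
        (ℓ (x + √x * w) / ℓ x) := by
    intro x w hx hw
    have hx0 : 0 < x := by linarith
    have hu0 : 0 < x + √x * w := by linarith
    simp only [Φ, f]
    rw [indicator_of_mem (mem_Ioi.2 hw), Real.div_rpow hu0.le hx0.le]
    have e : (x + √x * w - x) ^ 2 / (x + √x * w) = w ^ 2 / ((x + √x * w) / x) := by
      rw [add_sub_cancel_left, mul_pow, Real.sq_sqrt hx0.le]
      field_simp
    rw [e]
    have := (hX x hx).1
    field_simp
  have hlimv : ∀ w : ℝ, Tendsto (fun x : ℝ => (x + √x * w) / x) atTop (𝓝 1) := by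
    intro w
    have h1 : Tendsto (fun x : ℝ => 1 + w * (√x)⁻¹) atTop (𝓝 (1 + w * 0)) :=
      ((tendsto_inv_atTop_zero.comp Real.tendsto_sqrt_atTop).const_mul w).const_add 1
    rw [mul_zero, add_zero] at h1
    refine h1.congr' ?_
    filter_upwards [eventually_gt_atTop 0] with x hx
    have : 0 < √x := Real.sqrt_pos.2 hx
    have h2 : x = √x * √x := (Real.mul_self_sqrt hx.le).symm
    rw [add_div, div_self hx.ne']
    congr 1
    nth_rw 3 [h2]
    field_simp
  obtain ⟨C₁, hC₁0, hC₁⟩ := exists_exp_neg_sq_div_mul_rpow_le (lam - 2 + δ) hc0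
  obtain ⟨C₂, hC₂0, hC₂⟩ := exists_exp_neg_sq_div_mul_rpow_le (lam - 2 + -δ) hc0
  have hgauss := integral_gaussian c
  rw [← hgauss]
  refine Tendsto.congr' hΦ ?_
  refine tendsto_integral_filter_of_dominated_convergence
    (fun w => Real.exp 1 * (C₁ + C₂) * (1 + |w|) ^ (-2 : ℝ)) ?_ ?_ ?_ ?_
  · refine Eventually.of_forall fun x => ?_
    have hf : Measurable (f x) := by
      classical
      simp only [f]
      rw [← piecewise_eq_indicator]
      refine ContinuousOn.measurable_piecewise (fun u hu => ?_) continuousOn_const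
        measurableSet_Ioi
      have hu0 : 0 < u := hX0.trans hu
      refine ContinuousWithinAt.mul ?_ (ContinuousWithinAt.mul ?_ ?_)
      · exact ContinuousAt.continuousWithinAt (by fun_prop (disch := exact hu0.ne'))
      · exact (Real.continuousAt_rpow_const _ _ (Or.inl hu0.ne')).continuousWithinAt
      · exact (hc.continuousAt (Ioi_mem_nhds hu0)).continuousWithinAt
    exact ((hf.comp (by fun_prop)).div_const _).aestronglyMeasurable
  · filter_upwards [eventually_ge_atTop X] with x hx
    refine Eventually.of_forall fun w => ?_
    have hx0 : 0 < x := by linarith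
    have hlx := (hX x hx).1
    by_cases hw : X < x + √x * w
    · rw [hval x w hx hw]
      have h1 := (hX x hx).2 _ hw.le
      have hlu := (hX _ hw.le).1
      have hu0 : 0 < x + √x * w := by linarith
      have hsx : 1 ≤ √x := Real.one_le_sqrt.2 (by linarith)
      have hsq : √x * √x = x := Real.mul_self_sqrt hx0.le
      have hv : (x + √x * w) / x = 1 + w / √x := by
        rw [add_div, div_self hx0.ne', add_right_inj, div_eq_div_iff hx0.ne' (by positivity)]
        linear_combination w * hsq
      have hv0 : 0 < (x + √x * w) / x := by positivity
      have hv1 : (x + √x * w) / x ≤ 1 + |w| := by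
        rw [hv]
        gcongr
        exact (div_le_div_of_nonneg_right (le_abs_self w) (by positivity)).trans
          (div_le_self (abs_nonneg w) hsx)
      -- As `v = 1 + w / √x` and `√x ≥ 1`, having `v < 1 / 2` forces `w < -1 / 2`.
      have hv2 : 1 / 2 ≤ (x + √x * w) / x ∨ 1 / 4 ≤ w ^ 2 := by
        by_contra! hcon
        rw [hv] at hcon
        have h3 : w / √x < -(1 / 2) := by linarith [hcon.1]
        rw [div_lt_iff₀ (by positivity)] at h3
        nlinarith [hcon.2]
      have hb1 := hC₁ _ w hv0 hv1 hv2
      have hb2 := hC₂ _ w hv0 hv1 hv2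
      set v := (x + √x * w) / x
      rw [Real.norm_of_nonneg (by positivity)]
      rw [Real.rpow_add hv0] at hb1 hb2
      calc _ ≤ Real.exp (-(c * (w ^ 2 / v))) * v ^ (lam - 2) *
            (Real.exp 1 * (v ^ δ + v ^ (-δ))) := by gcongr
        _ = Real.exp 1 * (Real.exp (-(c * (w ^ 2 / v))) * (v ^ (lam - 2) * v ^ δ) +
            Real.exp (-(c * (w ^ 2 / v))) * (v ^ (lam - 2) * v ^ (-δ))) := by ring
        _ ≤ Real.exp 1 * (C₁ * (1 + |w|) ^ (-2 : ℝ) + C₂ * (1 + |w|) ^ (-2 : ℝ)) := by gcongr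
        _ = _ := by ring
    · simp only [Φ, f]
      rw [indicator_of_notMem (by simpa using hw), zero_div, norm_zero]
      positivity
  · exact (integrable_one_add_norm (by simp)).const_mul _
  · refine Eventually.of_forall fun w => ?_
    have h1 := hs.tendsto_div_of_tendsto_div_one hc hpos (hlimv w)
    have h2 : Tendsto (fun x : ℝ => Real.exp (-(c * (w ^ 2 / ((x + √x * w) / x)))) *
        ((x + √x * w) / x) ^ (lam - 2)) atTop
          (𝓝 (Real.exp (-(c * (w ^ 2 / 1))) * 1 ^ (lam - 2))) := by
      refine Tendsto.mul ?_ ((hlimv w).rpow_const (Or.inl one_ne_zero))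
      exact (Real.continuous_exp.tendsto _).comp
        (((tendsto_const_nhds.div (hlimv w) one_ne_zero).const_mul c).neg)
    have h3 := h2.mul h1
    rw [div_one, Real.one_rpow, mul_one, mul_one, ← neg_mul] at h3
    refine h3.congr' ?_
    have h4 : Tendsto (fun x : ℝ => x + √x * w) atTop atTop := by
      have := (hlimv w).pos_mul_atTop one_pos tendsto_id
      refine this.congr' ?_
      filter_upwards [eventually_ne_atTop 0] with x hx
      simp [div_mul_cancel₀ _ hx]
    filter_upwards [eventually_ge_atTop X, h4.eventually_gt_atTop X] with x hx hx'
    exact (hval x w hx hx').symm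

/-! ### From the tail of the density to the mixture. -/

theorem tendsto_exp_neg_sq_add_mul_rpow_atTop (a s : ℝ) {b : ℝ} (hb : 0 < b) :
    Tendsto (fun x : ℝ => Real.exp (-(b * x ^ 2) + a * x) * x ^ s) atTop (𝓝 0) := by
  have h := tendsto_rpow_mul_exp_neg_mul_atTop_nhds_zero s 1 one_pos
  refine tendsto_of_tendsto_of_tendsto_of_le_of_le' tendsto_const_nhds h ?_ ?_
  · filter_upwards [eventually_gt_atTop 0] with x hx
    positivity
  · filter_upwards [eventually_gt_atTop 0, eventually_ge_atTop ((a + 1) / b)] with x hx hx'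
    rw [mul_comm]
    gcongr
    rw [div_le_iff₀ hb] at hx'
    nlinarith

theorem SlowlyVarying.of_tendsto_div {ℓ L : ℝ → ℝ} (hL : SlowlyVarying L) {c : ℝ} (hc : c ≠ 0)
    (h : Tendsto (fun x => ℓ x / L x) atTop (𝓝 c)) : SlowlyVarying ℓ := by
  intro t ht
  have htx : Tendsto (fun x : ℝ => t * x) atTop atTop := tendsto_id.const_mul_atTop ht
  have h1 := ((h.comp htx).mul (hL t ht)).div h hc
  rw [mul_one, div_self hc] at h1
  refine h1.congr' ?_
  have hne := h.eventually_ne hc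
  filter_upwards [hne, htx.eventually hne] with x hx hx'
  have h2 : L x ≠ 0 := fun h0 => hx (by simp [h0])
  have h3 : L (t * x) ≠ 0 := fun h0 => hx' (by simp [h0])
  simp only [Function.comp, Pi.div_apply]
  field_simp

/-- Potter's bound against the fixed point `X` shows that `ℓ` decays no faster than a power, so the
main term cannot be beaten by the Gaussian-small contribution of `(0, X]`. -/
theorem inv_le_mul_rpow_of_potter {ℓ : ℝ → ℝ} {δ X : ℝ} (hδ : 0 ≤ δ) (hX1 : 1 ≤ X)
    (hX : ∀ x, X ≤ x → 0 < ℓ x ∧ ∀ y, X ≤ y →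
      ℓ y / ℓ x ≤ Real.exp 1 * ((y / x) ^ δ + (y / x) ^ (-δ))) {x : ℝ} (hx : X ≤ x) :
    (ℓ x)⁻¹ ≤ Real.exp 1 * 2 / ℓ X * x ^ δ := by
  have h1 := (hX x hx).2 X le_rfl
  have hlX := (hX X le_rfl).1
  have hx1 : 1 ≤ x := hX1.trans hx
  have hx0 : 0 < x := by linarith
  have hX0 : 0 < X := by linarith
  have h2 : (X / x) ^ δ ≤ x ^ δ := by
    gcongr
    exact ((div_le_one hx0).2 hx).trans hx1
  have h3 : (X / x) ^ (-δ) ≤ x ^ δ := by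
    rw [Real.rpow_neg (by positivity), ← Real.inv_rpow (by positivity), inv_div]
    gcongr
    exact div_le_self hx0.le hX1
  calc (ℓ x)⁻¹ = ℓ X / ℓ x / ℓ X := by field_simp
    _ ≤ Real.exp 1 * (x ^ δ + x ^ δ) / ℓ X := by
      gcongr
      exact h1.trans (by gcongr)
    _ = _ := by ring

theorem tendsto_div_of_add_of_le {A B E N D ρ : ℝ → ℝ} {C c : ℝ} (hρ : ∀ r, ρ r = A r + B r)
    (hA0 : ∀ r, 0 ≤ A r) (hAE : ∀ r, A r ≤ E r) (hN : ∀ᶠ r in atTop, 0 < N r)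
    (hE : Tendsto (fun r => E r / N r) atTop (𝓝 0))
    (hB : Tendsto (fun r => B r / N r) atTop (𝓝 C))
    (hD : Tendsto (fun r => N r / D r) atTop (𝓝 c)) :
    Tendsto (fun r => ρ r / D r) atTop (𝓝 (C * c)) := by
  have hA : Tendsto (fun r => A r / N r) atTop (𝓝 0) := by
    refine tendsto_of_tendsto_of_tendsto_of_le_of_le' tendsto_const_nhds hE ?_ ?_
    · filter_upwards [hN] with r hr using div_nonneg (hA0 r) hr.le
    · filter_upwards [hN] with r hr using div_le_div_of_nonneg_right (hAE r) hr.le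
  have h := (hA.add hB).mul hD
  rw [zero_add] at h
  refine h.congr' ?_
  filter_upwards [hN] with r hr
  rw [hρ, ← add_div, div_mul_div_cancel₀ hr.ne']

section

variable {G : Measure ℝ} {g : ℝ → ℝ}

theorem exp_neg_sq_div_le_one {r u : ℝ} (hu : 0 < u) :
    Real.exp (-(r ^ 2 / (2 * u))) ≤ 1 := by
  rw [Real.exp_le_one_iff, neg_nonpos]
  positivity

theorem integrable_exp_neg_sq_div (G : Measure ℝ) [IsFiniteMeasure G] (r : ℝ) :
    IntegrableOn (fun u : ℝ => Real.exp (-(r ^ 2 / (2 * u)))) (Ioi 0) G := by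
  refine Integrable.of_bound
    (by fun_prop : Measurable fun u : ℝ => Real.exp (-(r ^ 2 / (2 * u)))).aestronglyMeasurable
    1 ?_
  filter_upwards [ae_restrict_mem measurableSet_Ioi] with u hu
  rw [Real.norm_of_nonneg (by positivity)]
  exact exp_neg_sq_div_le_one hu

theorem setIntegral_Ioi_eq_add (hg_cont : ContinuousOn g (Ioi 0))
    (hg_nonneg : ∀ u : ℝ, 0 < u → 0 ≤ g u) [IsFiniteMeasure G]
    (hG : G = (volume.restrict (Ioi (0 : ℝ))).withDensity (fun u => ENNReal.ofReal (g u)))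
    {X : ℝ} (hX : 0 < X) (r : ℝ) :
    ∫ u in Ioi 0, Real.exp (-(r ^ 2 / (2 * u))) ∂G =
      (∫ u in Ioc 0 X, Real.exp (-(r ^ 2 / (2 * u))) ∂G) +
        ∫ u in Ioi X, Real.exp (-(r ^ 2 / (2 * u))) * g u := by
  have hint := integrable_exp_neg_sq_div G r
  have hgm : AEMeasurable g (volume.restrict (Ioi 0)) :=
    (hg_cont.aestronglyMeasurable measurableSet_Ioi).aemeasurable
  rw [← Ioc_union_Ioi_eq_Ioi hX.le, setIntegral_union (Ioc_disjoint_Ioi le_rfl)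
    measurableSet_Ioi (hint.mono_set Ioc_subset_Ioi_self)
    (hint.mono_set (Ioi_subset_Ioi hX.le))]
  congr 1
  have hsub : Ioi X ⊆ Ioi (0 : ℝ) := Ioi_subset_Ioi hX.le
  rw [hG, restrict_withDensity measurableSet_Ioi, Measure.restrict_restrict measurableSet_Ioi,
    inter_eq_left.2 hsub, integral_withDensity_eq_integral_toReal_smul₀
      (hgm.mono_set hsub).ennreal_ofReal (Eventually.of_forall fun _ => ENNReal.ofReal_lt_top)]
  refine setIntegral_congr_fun measurableSet_Ioi fun u hu => ?_
  simp only [smul_eq_mul]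
  rw [ENNReal.toReal_ofReal (hg_nonneg u (hsub hu)), mul_comm]

theorem setIntegral_Ioc_exp_neg_sq_div_le [IsProbabilityMeasure G] (X r : ℝ) :
    ∫ u in Ioc 0 X, Real.exp (-(r ^ 2 / (2 * u))) ∂G ≤ Real.exp (-(r ^ 2 / (2 * X))) := by
  have h1 : ∫ u in Ioc 0 X, Real.exp (-(r ^ 2 / (2 * u))) ∂G ≤
      ∫ u in Ioc 0 X, Real.exp (-(r ^ 2 / (2 * X))) ∂G := by
    refine setIntegral_mono_on ((integrable_exp_neg_sq_div G r).mono_set Ioc_subset_Ioi_self)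
      (integrableOn_const (by finiteness)) measurableSet_Ioc fun u hu => ?_
    have hu0 : 0 < u := hu.1
    have := hu.2
    gcongr
  refine h1.trans ?_
  rw [setIntegral_const, smul_eq_mul]
  exact mul_le_of_le_one_left (by positivity) measureReal_le_one

/-- The density divided by `exp (-c₀ u) u ^ (lam - 2)` inherits slow variation. -/
theorem slowlyVarying_of_asympProportional {L : ℝ → ℝ} {c₀ lam : ℝ} (hL : SlowlyVarying L)
    (hg_cont : ContinuousOn g (Ioi 0)) (hg_nonneg : ∀ u : ℝ, 0 < u → 0 ≤ g u)
    (h : AsympProportional atTop g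
      (fun u : ℝ => Real.exp (-(c₀ * u)) * u ^ (lam - 2) * L u)) :
    ∃ ℓ : ℝ → ℝ, SlowlyVarying ℓ ∧ ContinuousOn ℓ (Ioi 0) ∧ (∀ᶠ x in atTop, 0 < ℓ x) ∧
      (∀ u, 0 < u → g u = Real.exp (-(c₀ * u)) * (u ^ (lam - 2) * ℓ u)) ∧
      ∃ c, 0 < c ∧ Tendsto (fun x => ℓ x / L x) atTop (𝓝 c) := by
  obtain ⟨c, hc, hlim⟩ := h
  have hlim' : Tendsto (fun x => g x / (Real.exp (-(c₀ * x)) * x ^ (lam - 2)) / L x) atTop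
      (𝓝 c) := by
    refine hlim.congr fun x => ?_
    rw [div_div]
  -- `L` itself carries no regularity; this quotient inherits continuity and nonnegativity from `g`,
  -- and a nonzero limit against `L` makes it eventually positive.
  refine ⟨fun u => g u / (Real.exp (-(c₀ * u)) * u ^ (lam - 2)),
    hL.of_tendsto_div hc.ne' hlim', ?_, ?_, ?_, c, hc, hlim'⟩
  · refine hg_cont.div (ContinuousOn.mul (by fun_prop) fun u hu => ?_) fun u hu => ?_
    · exact (Real.continuousAt_rpow_const _ _ (Or.inl (mem_Ioi.1 hu).ne')).continuousWithinAt
    · have hu0 : 0 < u := hu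
      positivity
  · filter_upwards [hlim.eventually_ne hc.ne', eventually_gt_atTop 0] with x hx hx0
    have : g x ≠ 0 := fun h0 => hx (by simp [h0])
    have := (hg_nonneg x hx0).lt_of_ne' this
    positivity
  · intro u hu
    field_simp

theorem asympProportional_setIntegral_of_rpow_tail (hg_cont : ContinuousOn g (Ioi 0))
    (hg_nonneg : ∀ u : ℝ, 0 < u → 0 ≤ g u) [IsProbabilityMeasure G]
    (hG : G = (volume.restrict (Ioi (0 : ℝ))).withDensity (fun u => ENNReal.ofReal (g u)))
    {L : ℝ → ℝ} {lam : ℝ} (hL : SlowlyVarying L) (hlam : lam < 1)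
    (h : AsympProportional atTop g
      (fun u : ℝ => Real.exp (-(0 * u)) * u ^ (lam - 2) * L u)) :
    AsympProportional atTop (fun r : ℝ => ∫ u in Ioi 0, Real.exp (-(r ^ 2 / (2 * u))) ∂G)
      (fun r => r ^ (2 * lam - 2) * L (r ^ 2)) := by
  obtain ⟨ℓ, hs, hcont, hpos, hgl, c, hc, hlim⟩ :=
    slowlyVarying_of_asympProportional hL hg_cont hg_nonneg h
  -- Any `δ` strictly between `0` and `1 - lam` would do.
  have hδ : 0 < (1 - lam) / 2 := by linarith
  obtain ⟨X, hX1, hX⟩ := hs.exists_div_le hcont hpos hδ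
  have hX0 : 0 < X := by linarith
  have hsq : Tendsto (fun r : ℝ => r ^ 2) atTop atTop := tendsto_pow_atTop two_ne_zero
  refine ⟨(∫ v in Ioi (0 : ℝ), Real.exp (-(1 / (2 * v))) * v ^ (lam - 2)) * c,
    mul_pos (setIntegral_exp_neg_inv_mul_rpow_pos (by linarith)) hc, ?_⟩
  refine tendsto_div_of_add_of_le (N := fun r => r ^ (2 * lam - 2) * ℓ (r ^ 2))
    (setIntegral_Ioi_eq_add hg_cont hg_nonneg hG hX0)
    (fun r => setIntegral_nonneg measurableSet_Ioc fun u _ => (Real.exp_pos _).le)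
    (setIntegral_Ioc_exp_neg_sq_div_le X) ?_ ?_ ?_ ?_
  · filter_upwards [eventually_gt_atTop 0, hsq.eventually hpos] with r hr hr'
    positivity
  · have h0 := (tendsto_exp_neg_sq_add_mul_rpow_atTop 0
      (-(2 * lam - 2) + 2 * ((1 - lam) / 2)) (b := 1 / (2 * X)) (by positivity)).const_mul
        (Real.exp 1 * 2 / ℓ X)
    rw [mul_zero] at h0
    refine tendsto_of_tendsto_of_tendsto_of_le_of_le' tendsto_const_nhds h0 ?_ ?_
    · filter_upwards [eventually_gt_atTop 0, hsq.eventually hpos] with r hr hr'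
      positivity
    · filter_upwards [eventually_gt_atTop 0, hsq.eventually_ge_atTop X] with r hr hr'
      have h1 := inv_le_mul_rpow_of_potter hδ.le hX1 hX hr'
      rw [← Real.rpow_natCast r 2, ← Real.rpow_mul hr.le, Real.rpow_natCast] at h1
      rw [Real.rpow_add hr, Real.rpow_neg hr.le, div_eq_mul_inv, mul_inv, zero_mul, add_zero]
      calc _ ≤ Real.exp (-(r ^ 2 / (2 * X))) * ((r ^ (2 * lam - 2))⁻¹ *
            (Real.exp 1 * 2 / ℓ X * r ^ (((2 : ℕ) : ℝ) * ((1 - lam) / 2)))) := by gcongr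
        _ = _ := by
          rw [show r ^ 2 / (2 * X) = 1 / (2 * X) * r ^ 2 by ring]
          push_cast
          ring
  · refine (tendsto_setIntegral_exp_neg_sq_div_mul_rpow hs hcont hδ (by linarith) hX1 hX).congr
      fun r => ?_
    congr 1
    refine setIntegral_congr_fun measurableSet_Ioi fun u hu => ?_
    simp [hgl u (hX0.trans hu)]
  · refine (hlim.comp hsq).congr' ?_
    filter_upwards [eventually_gt_atTop 0] with r hr
    have : r ^ (2 * lam - 2) ≠ 0 := by positivity
    exact (mul_div_mul_left _ _ this).symm

theorem asympProportional_setIntegral_of_exp_tail (hg_cont : ContinuousOn g (Ioi 0))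
    (hg_nonneg : ∀ u : ℝ, 0 < u → 0 ≤ g u) [IsProbabilityMeasure G]
    (hG : G = (volume.restrict (Ioi (0 : ℝ))).withDensity (fun u => ENNReal.ofReal (g u)))
    {L : ℝ → ℝ} {c₀ lam : ℝ} (hL : SlowlyVarying L) (hc₀ : 0 < c₀)
    (h : AsympProportional atTop g
      (fun u : ℝ => Real.exp (-(c₀ * u)) * u ^ (lam - 2) * L u)) :
    AsympProportional atTop (fun r : ℝ => ∫ u in Ioi 0, Real.exp (-(r ^ 2 / (2 * u))) ∂G)
      (fun r => r ^ (lam - 3 / 2) * L r * Real.exp (-(√(2 * c₀) * r))) := by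
  obtain ⟨ℓ, hs, hcont, hpos, hgl, c, hc, hlim⟩ :=
    slowlyVarying_of_asympProportional hL hg_cont hg_nonneg h
  -- The Potter exponent need not be small here, because the exponential decay dominates every
  -- power.
  obtain ⟨X, hX1, hX⟩ := hs.exists_div_le hcont hpos one_pos
  have hX0 : 0 < X := by linarith
  have hk : 0 < √(2 * c₀) := by positivity
  have hksq : √(2 * c₀) ^ 2 = 2 * c₀ := Real.sq_sqrt (by positivity)
  set k := √(2 * c₀)
  have hsc : Tendsto (fun r : ℝ => k⁻¹ * r) atTop atTop :=
    tendsto_id.const_mul_atTop (by positivity)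
  have hkr : ∀ r : ℝ, r ^ 2 = 2 * c₀ * (k⁻¹ * r) ^ 2 := fun r => by
    rw [← hksq]; field_simp
  have hkr' : ∀ r : ℝ, k * r = 2 * c₀ * (k⁻¹ * r) := fun r => by
    rw [← hksq]; field_simp
  -- The factors come from the Gaussian integral, from the power of `k⁻¹ r`, from slow variation of
  -- `ℓ` (the `1`), and from the limit of `ℓ / L`.
  refine ⟨√(Real.pi / c₀) * ((k⁻¹) ^ (lam - 3 / 2) * (1 * c)), by positivity, ?_⟩
  refine tendsto_div_of_add_of_le
    (N := fun r => (k⁻¹ * r) ^ (lam - 3 / 2) * ℓ (k⁻¹ * r) * Real.exp (-(k * r)))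
    (setIntegral_Ioi_eq_add hg_cont hg_nonneg hG hX0)
    (fun r => setIntegral_nonneg measurableSet_Ioc fun u _ => (Real.exp_pos _).le)
    (setIntegral_Ioc_exp_neg_sq_div_le X) ?_ ?_ ?_ ?_
  · filter_upwards [eventually_gt_atTop 0, hsc.eventually hpos] with r hr hr'
    positivity
  · have h0 := ((tendsto_exp_neg_sq_add_mul_rpow_atTop (2 * c₀)
      (-(lam - 3 / 2) + 1) (b := c₀ / X) (by positivity)).const_mul
        (Real.exp 1 * 2 / ℓ X)).comp hsc
    rw [mul_zero] at h0
    refine tendsto_of_tendsto_of_tendsto_of_le_of_le' tendsto_const_nhds h0 ?_ ?_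
    · filter_upwards [eventually_gt_atTop 0, hsc.eventually hpos] with r hr hr'
      positivity
    · filter_upwards [eventually_gt_atTop 0, hsc.eventually_ge_atTop X] with r hr hr'
      have h1 := inv_le_mul_rpow_of_potter zero_le_one hX1 hX hr'
      rw [hkr r, hkr' r]
      simp only [Function.comp]
      have hx : 0 < k⁻¹ * r := by positivity
      generalize k⁻¹ * r = x at *
      rw [Real.rpow_add hx, Real.rpow_neg hx.le, div_eq_mul_inv, mul_inv, mul_inv,
        ← Real.exp_neg, neg_neg, Real.exp_add]
      calc _ ≤ Real.exp (-(2 * c₀ * x ^ 2 / (2 * X))) * ((x ^ (lam - 3 / 2))⁻¹ *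
            (Real.exp 1 * 2 / ℓ X * x ^ (1 : ℝ)) * Real.exp (2 * c₀ * x)) := by gcongr
        _ = _ := by
          rw [show 2 * c₀ * x ^ 2 / (2 * X) = c₀ / X * x ^ 2 by field_simp]
          ring
  · refine ((tendsto_setIntegral_exp_neg_sub_sq_div_mul_rpow hs hcont hpos lam hc₀ hX1
      hX).comp hsc).congr fun r => ?_
    simp only [Function.comp]
    rw [← mul_div_mul_right _ _ (Real.exp_pos (-(k * r))).ne', ← integral_mul_const]
    congr 1
    refine setIntegral_congr_fun measurableSet_Ioi fun u hu => ?_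
    have hu0 : 0 < u := hX0.trans hu
    simp only [hgl u hu0]
    rw [hkr r, hkr' r]
    generalize k⁻¹ * r = x
    -- Completing the square: the term `c₀ u` cancels the exponential factor of `g`, and `2 c₀ x = k
    -- r` is the exponential rate.
    rw [show -(2 * c₀ * x ^ 2 / (2 * u)) =
      -(c₀ * ((u - x) ^ 2 / u)) + -(2 * c₀ * x) + c₀ * u by field_simp; ring, Real.exp_add,
      Real.exp_add, Real.exp_neg (c₀ * u)]
    field_simp
  · have h1 := ((hs k⁻¹ (by positivity)).mul hlim).const_mul ((k⁻¹) ^ (lam - 3 / 2))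
    refine h1.congr' ?_
    filter_upwards [eventually_gt_atTop 0, hpos] with r hr hlr
    rw [Real.mul_rpow (by positivity) hr.le, div_mul_div_cancel₀ hlr.ne']
    have : r ^ (lam - 3 / 2) ≠ 0 := by positivity
    field_simp

end

theorem AsympProportional.comp_norm {d : ℕ} {f D : ℝ → ℝ} (h : AsympProportional atTop f D) :
    AsympProportional (Bornology.cobounded (EuclideanSpace ℝ (Fin d)))
      (fun x => f ‖x‖) (fun x => D ‖x‖) := by
  obtain ⟨c, hc, hlim⟩ := h
  exact ⟨c, hc, hlim.comp tendsto_norm_cobounded_atTop⟩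

/-! ### Transfer between Hilbert spaces with equal Gram kernels. -/

/-- A map into a Hilbert space is determined, up to a continuous linear map, by its Gram kernel. -/
theorem exists_continuousLinearMap_of_inner_eq {ι H H' : Type*} [NormedAddCommGroup H]
    [InnerProductSpace ℝ H] [CompleteSpace H] [NormedAddCommGroup H'] [InnerProductSpace ℝ H']
    [CompleteSpace H'] (φ : ι → H) (ψ : ι → H')
    (h : ∀ s t, inner ℝ (φ s) (φ t) = inner ℝ (ψ s) (ψ t)) :
    ∃ T : H →L[ℝ] H', ∀ s, T (φ s) = ψ s := by
  let A := Finsupp.linearCombination ℝ φ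
  let B := Finsupp.linearCombination ℝ ψ
  have hAB : ∀ x, ‖B x‖ = ‖A x‖ := by
    intro x
    have : inner ℝ (B x) (B x) = inner ℝ (A x) (A x) := by
      simp only [A, B, Finsupp.linearCombination_apply, Finsupp.sum, sum_inner, inner_sum,
        inner_smul_left, inner_smul_right, h]
    rw [real_inner_self_eq_norm_sq, real_inner_self_eq_norm_sq] at this
    exact (sq_eq_sq₀ (norm_nonneg _) (norm_nonneg _)).1 this
  let K := (LinearMap.range A).topologicalClosure
  have hK : CompleteSpace K :=
    (LinearMap.range A).isClosed_topologicalClosure.completeSpace_coe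
  let e : (ι →₀ ℝ) →ₗ[ℝ] K :=
    A.codRestrict K fun x => (LinearMap.range A).le_topologicalClosure ⟨x, rfl⟩
  have hdense : DenseRange e := by
    intro x
    rw [Topology.IsInducing.subtypeVal.closure_eq_preimage_closure_image, mem_preimage,
      ← range_comp]
    exact x.2
  have hext : ∀ x, B.extendOfNorm e (e x) = B x :=
    LinearMap.extendOfNorm_eq hdense ⟨1, fun x => by rw [one_mul, hAB]; rfl⟩
  refine ⟨(B.extendOfNorm e).comp K.orthogonalProjectionOnto, fun s => ?_⟩
  have hφ : φ s = (e (Finsupp.single s 1) : H) := by simp [e, A]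
  rw [ContinuousLinearMap.comp_apply, hφ, Submodule.orthogonalProjectionOnto_mem_subspace_eq_self,
    hext]
  simp [B]

/-! ### Smoothness of weighted characters as an `L²`-valued curve. -/

section

variable {α E : Type*} [NormedAddCommGroup E] [InnerProductSpace ℝ E]

/-- The weighted character `a ↦ exp (i ⟪s, X a⟫) p a`. -/
noncomputable def weightedChar (X : α → E) (p : α → ℂ) (s : E) (a : α) : ℂ :=
  Complex.exp (Complex.I * (inner ℝ s (X a) : ℝ)) * p a

theorem norm_weightedChar (X : α → E) (p : α → ℂ) (s : E) (a : α) :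
    ‖weightedChar X p s a‖ = ‖p a‖ := by
  rw [weightedChar, norm_mul, mul_comm Complex.I, Complex.norm_exp_ofReal_mul_I, one_mul]

theorem weightedChar_sub_weightedChar (X : α → E) (p : α → ℂ) (s t : E) (a : α) :
    weightedChar X p t a - weightedChar X p s a =
      weightedChar X p s a * (Complex.exp (Complex.I * (inner ℝ (t - s) (X a) : ℝ)) - 1) := by
  have : weightedChar X p t a = weightedChar X p s a *
      Complex.exp (Complex.I * (inner ℝ (t - s) (X a) : ℝ)) := by
    rw [weightedChar, weightedChar, mul_right_comm, ← Complex.exp_add, inner_sub_left]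
    push_cast
    ring_nf
  rw [this]
  ring

/-- The weight of the derivative of `weightedChar X p` in the direction `y`. -/
noncomputable def derivWeight (X : α → E) (p : α → ℂ) (y : E) (a : α) : ℂ :=
  Complex.I * (inner ℝ y (X a) : ℝ) * p a

theorem norm_derivWeight_le (X : α → E) (p : α → ℂ) (y : E) (a : α) :
    ‖derivWeight X p y a‖ ≤ ‖y‖ * (‖X a‖ * ‖p a‖) := by
  rw [derivWeight, norm_mul, norm_mul, Complex.norm_I, one_mul, Complex.norm_real, ← mul_assoc]
  gcongr
  exact norm_inner_le_norm y (X a)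

end

section

variable {α : Type*} [MeasurableSpace α] {μ : Measure α}

theorem MeasureTheory.MemLp.norm_toLp_two_sq {F : Type*} [NormedAddCommGroup F]
    [InnerProductSpace ℝ F] {f : α → F} (hf : MemLp f 2 μ) :
    ‖hf.toLp f‖ ^ 2 = ∫ a, ‖f a‖ ^ 2 ∂μ := by
  rw [← real_inner_self_eq_norm_sq, L2.inner_def]
  refine integral_congr_ae ?_
  filter_upwards [hf.coeFn_toLp] with a ha
  rw [ha, real_inner_self_eq_norm_sq]

/-- Dominated convergence to `0` in `L²`. -/
theorem tendsto_norm_toLp_of_dominated {ι F : Type*} {l : Filter ι} [l.IsCountablyGenerated]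
    [NormedAddCommGroup F] [InnerProductSpace ℝ F] {f : ι → α → F} (hf : ∀ i, MemLp (f i) 2 μ)
    {b : α → ℝ} (hb : MemLp b 2 μ) (hfb : ∀ i a, ‖f i a‖ ≤ b a)
    (hlim : ∀ a, Tendsto (fun i => ‖f i a‖) l (𝓝 0)) :
    Tendsto (fun i => ‖(hf i).toLp (f i)‖) l (𝓝 0) := by
  have h1 : Tendsto (fun i => ‖(hf i).toLp (f i)‖ ^ 2) l (𝓝 0) := by
    simp_rw [MemLp.norm_toLp_two_sq]
    rw [← integral_zero α ℝ (μ := μ)]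
    refine tendsto_integral_filter_of_dominated_convergence (fun a => b a ^ 2)
      (Eventually.of_forall fun i => (hf i).1.norm.pow 2)
      (Eventually.of_forall fun i => Eventually.of_forall fun a => ?_) hb.integrable_sq
      (Eventually.of_forall fun a => ?_)
    · rw [Real.norm_of_nonneg (by positivity)]
      gcongr
      exact hfb i a
    · simpa using (hlim a).pow 2
  have h2 := h1.sqrt
  simpa [Real.sqrt_sq (norm_nonneg _)] using h2

variable {E : Type*} [NormedAddCommGroup E] [InnerProductSpace ℝ E] [MeasurableSpace E]
  [BorelSpace E] [SecondCountableTopology E] {X : α → E}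

theorem memLp_weightedChar (hX : Measurable X) {p : α → ℂ} (hp : MemLp p 2 μ) (s : E) :
    MemLp (weightedChar X p s) 2 μ := by
  refine MemLp.of_le hp (AEStronglyMeasurable.mul ?_ hp.1)
    (Eventually.of_forall fun a => (norm_weightedChar X p s a).le)
  exact (by fun_prop : Measurable fun a =>
    Complex.exp (Complex.I * (inner ℝ s (X a) : ℝ))).aestronglyMeasurable

theorem continuous_toLp_weightedChar (hX : Measurable X) {p : α → ℂ} (hp : MemLp p 2 μ) :
    Continuous fun s => (memLp_weightedChar hX hp s).toLp (weightedChar X p s) := by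
  refine continuous_iff_continuousAt.2 fun s => ?_
  rw [ContinuousAt, tendsto_iff_norm_sub_tendsto_zero]
  simp_rw [← MemLp.toLp_sub]
  refine tendsto_norm_toLp_of_dominated
    (fun t => (memLp_weightedChar hX hp t).sub (memLp_weightedChar hX hp s))
    (b := fun a => 2 * ‖p a‖) (hp.norm.const_mul 2) (fun t a => ?_) fun a => ?_
  · refine (norm_sub_le _ _).trans ?_
    rw [norm_weightedChar, norm_weightedChar]
    linarith
  · have : Continuous fun t => ‖(weightedChar X p t - weightedChar X p s) a‖ := by
      simp only [weightedChar, Pi.sub_apply]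
      fun_prop
    simpa using this.tendsto s

theorem aestronglyMeasurable_derivWeight (hX : Measurable X) {p : α → ℂ}
    (hp : AEStronglyMeasurable p μ) (y : E) : AEStronglyMeasurable (derivWeight X p y) μ :=
  (by fun_prop : Measurable fun a =>
    Complex.I * (inner ℝ y (X a) : ℝ)).aestronglyMeasurable.mul hp

theorem memLp_derivWeight (hX : Measurable X) {p : α → ℂ} (hp : AEStronglyMeasurable p μ)
    (hXp : MemLp (fun a => ‖X a‖ * ‖p a‖) 2 μ) (y : E) : MemLp (derivWeight X p y) 2 μ := by
  refine hXp.of_le_mul (c := ‖y‖) (aestronglyMeasurable_derivWeight hX hp y)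
    (Eventually.of_forall fun a => ?_)
  rw [Real.norm_of_nonneg (by positivity)]
  exact norm_derivWeight_le X p y a

variable [FiniteDimensional ℝ E]

/-- The derivative of the `L²`-valued map given by `weightedChar X p`. -/
noncomputable def weightedCharDeriv (hX : Measurable X) {p : α → ℂ} (hp : MemLp p 2 μ)
    (hXp : MemLp (fun a => ‖X a‖ * ‖p a‖) 2 μ) (s : E) : E →L[ℝ] Lp ℂ 2 μ :=
  LinearMap.toContinuousLinearMap
    { toFun := fun y => (memLp_weightedChar hX (memLp_derivWeight hX hp.1 hXp y) s).toLp
        (weightedChar X (derivWeight X p y) s)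
      map_add' := fun y z => by
        rw [← MemLp.toLp_add]
        congr 1
        ext a
        simp only [weightedChar, derivWeight, inner_add_left, Pi.add_apply]
        push_cast
        ring
      map_smul' := fun c y => by
        rw [← MemLp.toLp_const_smul]
        congr 1
        ext a
        simp only [weightedChar, derivWeight, real_inner_smul_left, Pi.smul_apply,
          RingHom.id_apply, Complex.real_smul]
        push_cast
        ring }

theorem weightedCharDeriv_apply (hX : Measurable X) {p : α → ℂ} (hp : MemLp p 2 μ)
    (hXp : MemLp (fun a => ‖X a‖ * ‖p a‖) 2 μ) (s y : E) :
    weightedCharDeriv hX hp hXp s y =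
      (memLp_weightedChar hX (memLp_derivWeight hX hp.1 hXp y) s).toLp
        (weightedChar X (derivWeight X p y) s) := rfl

/-- Dominated convergence with two estimates of `exp (iθ) - 1 - iθ`: the bound `2|θ|` gives the
square-integrable majorant, and the bound `θ²` for small `θ` gives the pointwise limit. -/
theorem hasFDerivAt_toLp_weightedChar (hX : Measurable X) {p : α → ℂ} (hp : MemLp p 2 μ)
    (hXp : MemLp (fun a => ‖X a‖ * ‖p a‖) 2 μ) (s : E) :
    HasFDerivAt (fun s => (memLp_weightedChar hX hp s).toLp (weightedChar X p s))
      (weightedCharDeriv hX hp hXp s) s := by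
  rw [hasFDerivAt_iff_tendsto]
  have hmem : ∀ t : E, MemLp (‖t - s‖⁻¹ • (weightedChar X p t - weightedChar X p s -
      weightedChar X (derivWeight X p (t - s)) s)) 2 μ := fun t =>
    (((memLp_weightedChar hX hp t).sub (memLp_weightedChar hX hp s)).sub
      (memLp_weightedChar hX (memLp_derivWeight hX hp.1 hXp (t - s)) s)).const_smul _
  have heq : ∀ t a, (‖t - s‖⁻¹ • (weightedChar X p t - weightedChar X p s -
      weightedChar X (derivWeight X p (t - s)) s)) a = ‖t - s‖⁻¹ • (weightedChar X p s a *
        (Complex.exp (Complex.I * (inner ℝ (t - s) (X a) : ℝ)) - 1 -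
          Complex.I * (inner ℝ (t - s) (X a) : ℝ))) := by
    intro t a
    simp only [Pi.smul_apply, Pi.sub_apply]
    rw [weightedChar_sub_weightedChar]
    simp only [weightedChar, derivWeight]
    ring_nf
  have hnorm : ∀ t a, ‖(‖t - s‖⁻¹ • (weightedChar X p t - weightedChar X p s -
      weightedChar X (derivWeight X p (t - s)) s)) a‖ = ‖t - s‖⁻¹ * (‖p a‖ *
        ‖Complex.exp (Complex.I * (inner ℝ (t - s) (X a) : ℝ)) - 1 -
          Complex.I * (inner ℝ (t - s) (X a) : ℝ)‖) := by
    intro t a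
    rw [heq, norm_smul, norm_mul, norm_weightedChar, norm_inv, norm_norm]
  have hIn : ∀ t a, ‖Complex.I * (inner ℝ (t - s) (X a) : ℝ)‖ ≤ ‖t - s‖ * ‖X a‖ := by
    intro t a
    rw [norm_mul, Complex.norm_I, one_mul, Complex.norm_real]
    exact norm_inner_le_norm _ _
  have key := tendsto_norm_toLp_of_dominated (l := 𝓝 s) hmem
    (b := fun a => 2 * (‖X a‖ * ‖p a‖)) (hXp.const_mul 2) (fun t a => ?_) fun a => ?_
  · refine key.congr fun t => ?_
    rw [weightedCharDeriv_apply, ← MemLp.toLp_sub, ← MemLp.toLp_sub, MemLp.toLp_const_smul,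
      norm_smul, norm_inv, norm_norm]
  · rw [hnorm]
    rcases eq_or_ne t s with rfl | hts
    · simp only [sub_self, norm_zero, inv_zero, zero_mul]
      positivity
    have h0 : 0 < ‖t - s‖ := norm_pos_iff.2 (sub_ne_zero.2 hts)
    rw [inv_mul_le_iff₀ h0]
    have h1 := Real.norm_exp_I_mul_ofReal_sub_one_le (x := inner ℝ (t - s) (X a))
    have h2 : ‖(inner ℝ (t - s) (X a) : ℝ)‖ ≤ ‖t - s‖ * ‖X a‖ := norm_inner_le_norm _ _
    calc _ ≤ ‖p a‖ * (‖t - s‖ * ‖X a‖ + ‖t - s‖ * ‖X a‖) := by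
          gcongr
          exact (norm_sub_le _ _).trans (add_le_add (h1.trans h2) (hIn t a))
      _ = _ := by ring
  · have hlim : Tendsto (fun t => ‖t - s‖ * (‖p a‖ * ‖X a‖ ^ 2)) (𝓝 s) (𝓝 0) := by
      have : Continuous fun t => ‖t - s‖ * (‖p a‖ * ‖X a‖ ^ 2) := by fun_prop
      simpa using this.tendsto s
    refine tendsto_of_tendsto_of_tendsto_of_le_of_le' tendsto_const_nhds hlim
      (Eventually.of_forall fun t => norm_nonneg _) ?_
    have hsmall : ∀ᶠ t in 𝓝 s, ‖t - s‖ * ‖X a‖ < 1 := by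
      have : Continuous fun t => ‖t - s‖ * ‖X a‖ := by fun_prop
      exact (this.tendsto s).eventually_lt_const (by simp)
    filter_upwards [hsmall] with t ht
    rw [hnorm]
    rcases eq_or_ne t s with rfl | hts
    · simp
    have h0 : 0 < ‖t - s‖ := norm_pos_iff.2 (sub_ne_zero.2 hts)
    rw [inv_mul_le_iff₀ h0]
    calc _ ≤ ‖p a‖ * (‖t - s‖ * ‖X a‖) ^ 2 := by
          gcongr
          refine (Complex.norm_exp_sub_one_sub_id_le ((hIn t a).trans ht.le)).trans ?_
          gcongr
          exact hIn t a
      _ = _ := by ring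

/-- Each directional derivative is again a weighted character, with one more factor of `X` in the
weight. Induction therefore runs over all weights, trading one moment for one derivative. -/
theorem contDiff_toLp_weightedChar (hX : Measurable X) (m : ℕ) :
    ∀ {p : α → ℂ} (hp : MemLp p 2 μ), MemLp (fun a => (1 + ‖X a‖) ^ m * ‖p a‖) 2 μ →
      ContDiff ℝ m fun s => (memLp_weightedChar hX hp s).toLp (weightedChar X p s) := by
  induction m with
  | zero =>
    intro p hp _
    exact contDiff_zero.2 (continuous_toLp_weightedChar hX hp)
  | succ m ih =>
    intro p hp hm
    have hmeas : ∀ k : ℕ, AEStronglyMeasurable (fun a => (1 + ‖X a‖) ^ k) μ := fun k =>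
      (by fun_prop : Measurable fun a => (1 + ‖X a‖) ^ k).aestronglyMeasurable
    have hXp : MemLp (fun a => ‖X a‖ * ‖p a‖) 2 μ := by
      refine hm.of_le (hX.norm.aestronglyMeasurable.mul hp.1.norm)
        (Eventually.of_forall fun a => ?_)
      rw [Real.norm_of_nonneg (by positivity), Real.norm_of_nonneg (by positivity)]
      gcongr
      calc ‖X a‖ ≤ 1 + ‖X a‖ := by linarith
        _ ≤ (1 + ‖X a‖) ^ (m + 1) := le_self_pow₀ (by linarith [norm_nonneg (X a)]) (by simp)
    have hd := hasFDerivAt_toLp_weightedChar hX hp hXp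
    push_cast
    refine contDiff_succ_iff_fderiv_apply.2
      ⟨fun s => (hd s).differentiableAt, fun h => absurd h (by simp), fun y => ?_⟩
    simp_rw [(hd _).fderiv, weightedCharDeriv_apply]
    refine ih (memLp_derivWeight hX hp.1 hXp y) (hm.of_le_mul (c := ‖y‖)
      ((hmeas m).mul (aestronglyMeasurable_derivWeight hX hp.1 y).norm)
      (Eventually.of_forall fun a => ?_))
    rw [Real.norm_of_nonneg (by positivity), Real.norm_of_nonneg (by positivity)]
    calc (1 + ‖X a‖) ^ m * ‖derivWeight X p y a‖
        ≤ (1 + ‖X a‖) ^ m * (‖y‖ * ((1 + ‖X a‖) * ‖p a‖)) := by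
          gcongr
          refine (norm_derivWeight_le X p y a).trans ?_
          gcongr
          linarith
      _ = _ := by ring

end

/-! ### Spectral representation of the mixture and mean-square differentiability. -/

/-- The spectral variable of a normal scale mixture: `w / √u`. -/
noncomputable def spectralVariable {d : ℕ} (a : ℝ × EuclideanSpace ℝ (Fin d)) :
    EuclideanSpace ℝ (Fin d) :=
  √(1 / a.1) • a.2

theorem measurable_spectralVariable {d : ℕ} : Measurable (spectralVariable (d := d)) := by
  unfold spectralVariable
  fun_prop

/-- The mixing measure times the standard Gaussian measure. -/
noncomputable def spectralMeasure (d : ℕ) (G : Measure ℝ) :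
    Measure (ℝ × EuclideanSpace ℝ (Fin d)) :=
  (G.restrict (Ioi 0)).prod (stdGaussian (EuclideanSpace ℝ (Fin d)))

instance {d : ℕ} {G : Measure ℝ} [IsFiniteMeasure G] : IsFiniteMeasure (spectralMeasure d G) := by
  unfold spectralMeasure
  infer_instance

theorem integrable_exp_inner_spectralVariable {d : ℕ} (G : Measure ℝ) [IsFiniteMeasure G]
    (h : EuclideanSpace ℝ (Fin d)) :
    Integrable (fun a => Complex.exp (Complex.I * (inner ℝ h (spectralVariable a) : ℝ)))
      (spectralMeasure d G) := by
  have hm := measurable_spectralVariable (d := d)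
  refine Integrable.of_bound (by fun_prop :
    Measurable fun a => Complex.exp (Complex.I * (inner ℝ h (spectralVariable a) : ℝ))
    ).aestronglyMeasurable 1 (Eventually.of_forall fun a => ?_)
  rw [mul_comm, Complex.norm_exp_ofReal_mul_I]

theorem integral_exp_inner_spectralVariable {d : ℕ} (G : Measure ℝ) [IsProbabilityMeasure G]
    (h : EuclideanSpace ℝ (Fin d)) :
    ∫ a, Complex.exp (Complex.I * (inner ℝ h (spectralVariable a) : ℝ)) ∂(spectralMeasure d G) =
      normalScaleMixture G h := by
  rw [spectralMeasure, integral_prod _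
    (integrable_exp_inner_spectralVariable G h), normalScaleMixture, ← integral_complex_ofReal]
  refine setIntegral_congr_fun measurableSet_Ioi fun u hu => ?_
  have hu0 : 0 < u := hu
  have h1 := charFun_stdGaussian (√(1 / u) • h)
  rw [charFun_apply] at h1
  have h2 : (fun w : EuclideanSpace ℝ (Fin d) =>
      Complex.exp (Complex.I * (inner ℝ h (spectralVariable (u, w)) : ℝ))) =
      fun w => Complex.exp ((inner ℝ w (√(1 / u) • h) : ℝ) * Complex.I) := by
    ext w
    rw [spectralVariable, real_inner_smul_right, real_inner_smul_right, real_inner_comm, mul_comm]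
  simp only [h2, h1]
  rw [norm_smul, Real.norm_of_nonneg (Real.sqrt_nonneg _), Complex.ofReal_mul, mul_pow,
    ← Complex.ofReal_pow √(1 / u), Real.sq_sqrt (by positivity)]
  push_cast
  congr 1
  field_simp

/-- The square of `‖w / √u‖ ^ m` factors as `u ^ (-m)` times `‖w‖ ^ (2m)`, so the negative moment of
`G` and the Gaussian moments suffice on the product space. -/
theorem memLp_spectralVariable {d m : ℕ} {G : Measure ℝ} [IsProbabilityMeasure G]
    (hm : Integrable (fun u : ℝ => (1 / u) ^ m) G) :
    MemLp (fun a : ℝ × EuclideanSpace ℝ (Fin d) => (1 + ‖spectralVariable a‖) ^ m * ‖(1 : ℂ)‖) 2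
      (spectralMeasure d G) := by
  have hmeas := measurable_spectralVariable (d := d)
  have h1 : Integrable (fun u : ℝ => (√(1 / u)) ^ (2 * m)) (G.restrict (Ioi 0)) := by
    refine hm.integrableOn.congr ?_
    filter_upwards [ae_restrict_mem measurableSet_Ioi] with u hu
    have hu0 : 0 < u := hu
    rw [pow_mul, Real.sq_sqrt (by positivity)]
  have h2 : Integrable (fun w => ‖w‖ ^ (2 * m)) (stdGaussian (EuclideanSpace ℝ (Fin d))) :=
    (IsGaussian.memLp_id _ ((2 * m : ℕ) : ENNReal) (by finiteness)).integrable_norm_pow'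
  have h3 : MemLp (fun a : ℝ × EuclideanSpace ℝ (Fin d) => ‖spectralVariable a‖ ^ m) 2
      (spectralMeasure d G) := by
    refine (memLp_two_iff_integrable_sq (by fun_prop : Measurable
      fun a : ℝ × EuclideanSpace ℝ (Fin d) => ‖spectralVariable a‖ ^ m).aestronglyMeasurable).2 ?_
    refine (h1.mul_prod h2).congr (Eventually.of_forall fun a => ?_)
    simp only [spectralVariable]
    rw [norm_smul, Real.norm_of_nonneg (Real.sqrt_nonneg _), ← mul_pow, ← pow_mul, mul_comm 2]
  -- The constant is the convexity one in `(1 + y) ^ m ≤ 2 ^ (m - 1) (1 + y ^ m)`.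
  refine ((memLp_const (1 : ℝ)).add h3).of_le_mul (c := 2 ^ (m - 1)) (by fun_prop : Measurable
    fun a : ℝ × EuclideanSpace ℝ (Fin d) =>
      (1 + ‖spectralVariable a‖) ^ m * ‖(1 : ℂ)‖).aestronglyMeasurable
    (Eventually.of_forall fun a => ?_)
  rw [Real.norm_of_nonneg (by positivity), Pi.add_apply, Real.norm_of_nonneg (by positivity),
    norm_one, mul_one]
  simpa using add_pow_le zero_le_one (norm_nonneg (spectralVariable a)) m

theorem inner_toLp_weightedChar_spectralVariable {d : ℕ} (G : Measure ℝ) [IsProbabilityMeasure G]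
    (h1 : MemLp (fun _ => (1 : ℂ)) 2 (spectralMeasure d G)) (s t : EuclideanSpace ℝ (Fin d)) :
    inner ℝ
      ((memLp_weightedChar measurable_spectralVariable h1 s).toLp
        (weightedChar spectralVariable (fun _ => (1 : ℂ)) s))
      ((memLp_weightedChar measurable_spectralVariable h1 t).toLp
        (weightedChar spectralVariable (fun _ => (1 : ℂ)) t)) =
      normalScaleMixture G (t - s) := by
  rw [L2.inner_def]
  have h3 := congrArg Complex.re (integral_exp_inner_spectralVariable G (t - s))
  rw [Complex.ofReal_re, ← RCLike.re_eq_complex_re, ← integral_re (integrable_exp_inner_spectralVariable G (t - s))] at h3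
  rw [← h3]
  refine integral_congr_ae ?_
  filter_upwards [(memLp_weightedChar measurable_spectralVariable h1 s).coeFn_toLp,
    (memLp_weightedChar measurable_spectralVariable h1 t).coeFn_toLp] with a hs ht
  rw [hs, ht, Complex.inner, RCLike.re_eq_complex_re]
  congr 1
  simp only [weightedChar, mul_one]
  rw [← Complex.exp_conj, ← Complex.exp_add, map_mul, Complex.conj_I, Complex.conj_ofReal,
    inner_sub_left]
  push_cast
  ring_nf

/-- The process minus its constant mean is the image of the character curve under a continuous
linear map; Gaussianity serves to make the variables square integrable. -/
theorem isMeanSquareDifferentiable_of_integrable_inv_pow {d m : ℕ} {G : Measure ℝ}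
    [IsProbabilityMeasure G] (hm : Integrable (fun u : ℝ => (1 / u) ^ m) G) {Ω : Type*}
    [MeasurableSpace Ω] {P : Measure Ω} [IsProbabilityMeasure P]
    {Z : EuclideanSpace ℝ (Fin d) → Ω → ℝ}
    (hZ : IsStationaryGaussianProcess Z (normalScaleMixture G) P) :
    IsMeanSquareDifferentiable m Z P := by
  have hmem : ∀ s, MemLp (Z s) 2 P := fun s => (hZ.isGaussian.hasGaussianLaw_eval s).memLp_two
  obtain ⟨c, hc⟩ := hZ.mean_const
  have hcmem : MemLp (fun _ : Ω => c) 2 P := memLp_const c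
  have h1 : MemLp (fun _ => (1 : ℂ)) 2 (spectralMeasure d G) := memLp_const 1
  obtain ⟨T, hT⟩ := exists_continuousLinearMap_of_inner_eq
    (fun s => (memLp_weightedChar measurable_spectralVariable h1 s).toLp
      (weightedChar spectralVariable (fun _ => (1 : ℂ)) s))
    (fun s => (hmem s).toLp (Z s) - hcmem.toLp _) (by
      intro s t
      rw [inner_toLp_weightedChar_spectralVariable G h1, ← neg_sub s t, normalScaleMixture, norm_neg,
        ← normalScaleMixture, ← hZ.cov_eq, ← MemLp.toLp_sub, ← MemLp.toLp_sub, L2.inner_def,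
        covariance, hc, hc]
      refine integral_congr_ae ?_
      filter_upwards [((hmem s).sub hcmem).coeFn_toLp, ((hmem t).sub hcmem).coeFn_toLp]
        with ω hs ht
      rw [hs, ht]
      simp [mul_comm])
  have hcd : ContDiff ℝ m fun s => (hmem s).toLp (Z s) := by
    have h2 := (T.contDiff.comp (contDiff_toLp_weightedChar measurable_spectralVariable m h1
      (memLp_spectralVariable hm))).add (contDiff_const (c := hcmem.toLp _))
    refine (funext fun s => ?_ : (fun s => (hmem s).toLp (Z s)) = _) ▸ h2
    exact (eq_add_of_sub_eq (hT s).symm)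
  exact ⟨hmem, fun k hk => hcd.differentiable_iteratedFDeriv (by exact_mod_cast hk)⟩

theorem theorem2 (d : ℕ) (G : Measure ℝ) [IsProbabilityMeasure G] (g : ℝ → ℝ)
    (hg_cont : ContinuousOn g (Ioi 0)) (hg_nonneg : ∀ u : ℝ, 0 < u → 0 ≤ g u)
    (hG : G = (volume.restrict (Ioi (0 : ℝ))).withDensity (fun u => ENNReal.ofReal (g u))) :
    (∀ m : ℕ, Integrable (fun u : ℝ => (1 / u) ^ m) G →
      ∀ {Ω : Type*} [MeasurableSpace Ω] (P : Measure Ω) [IsProbabilityMeasure P]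
        (Z : EuclideanSpace ℝ (Fin d) → Ω → ℝ),
        IsStationaryGaussianProcess Z (normalScaleMixture G) P →
          IsMeanSquareDifferentiable m Z P) ∧
    (∀ (L : ℝ → ℝ) (c₀ lam : ℝ), SlowlyVarying L → 0 ≤ c₀ →
      AsympProportional atTop g
        (fun u : ℝ => Real.exp (-(c₀ * u)) * u ^ (lam - 2) * L u) →
      (c₀ = 0 → lam < 1 →
        AsympProportional (Bornology.cobounded (EuclideanSpace ℝ (Fin d)))
          (normalScaleMixture G)
          (fun h => ‖h‖ ^ (2 * lam - 2) * L (‖h‖ ^ 2))) ∧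
      (0 < c₀ →
        AsympProportional (Bornology.cobounded (EuclideanSpace ℝ (Fin d)))
          (normalScaleMixture G)
          (fun h => ‖h‖ ^ (lam - 3 / 2) * L ‖h‖ * Real.exp (-(Real.sqrt (2 * c₀) * ‖h‖))))) := by
  refine ⟨fun m hm Ω _ P _ Z hZ => isMeanSquareDifferentiable_of_integrable_inv_pow hm hZ,
    fun L c₀ lam hL _ hgL => ⟨?_, fun hc₀ => ?_⟩⟩
  · rintro rfl hlam
    exact (asympProportional_setIntegral_of_rpow_tail hg_cont hg_nonneg hG hL hlam hgL).comp_norm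
  · exact (asympProportional_setIntegral_of_exp_tail hg_cont hg_nonneg hG hL hc₀ hgL).comp_norm
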